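/- Let $R$ be a discrete valuation ring with fraction field $K$, let $L/K$ be a finite field extension, and let $S$ be the integral closure of $R$ in $L$. For $n\ge 0$ and a commutative ring $T$, call $A,B\in \mathrm{Mat}_n(T)$ similar over $T$ if $B=UAU^{-1}$ for some $U\in \mathrm{GL}_n(T)$. Let $A,B\in\mathrm{Mat}_n(R)$, and suppose that at least one of the following holds: 1. the characteristic polynomial of $A$ is separable as a polynomial over $K$ (that is, it is coprime to its derivative in $K[x]$, equivalently it has no multiple root in an algebraic closure of $K$); 2. $n=2$. Then $A$ and $B$ are similar over $R$ if and only if they are similar over $S$. In particular, if $A$ and $B$ are similar over $S$, then they are already similar over $R$. -/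

import Mathlib

/-!
Let `E` be the centralizer of `B` and `H` the left `E`-module of matrices `X` with `X * A = B * X`.
If a unit `U` over a finite free extension `S` of `R` conjugates `A` to `B`, then `Z ↦ Z * U`
identifies the scalar extensions of `E` and `H`; in a basis of `S` of size `d` this says that `d`
elements generate `H ^ d` over `E`. Hence `Hom_E(H, T) ^ d` embeds in `T ^ d`, so that
`length Hom_E(H, T) ≤ length T` for every simple `E`-module `T`.

Over a semilocal base this bound makes `H` cyclic. The quotient `Y` of `H` by its radical is
semisimple of finite length, so choose `y` with `E y` maximal among cyclic submodules. If `E y` had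
a complement `C ≠ 0`, take a simple `N ≤ C`. An `a` with `a y = 0` kills every `t` in `N`, since
otherwise `E (y + t)` would be larger than `E y`. So `y` can be sent to any `t` in `N`, the module
`Hom(Y, N)` maps onto `N × Hom(C, N)`, and its length exceeds that of `N`. A generator of `Y` lifts
to a generator `f` of `H` by Nakayama.

Now `f` is a right factor of `U` over `S`, so it is invertible over `S`, hence over `R`. An integral
torsion-free extension of a principal ideal domain reduces to the finite free case, because the
entries of `U` and `U⁻¹` lie in a finitely generated subalgebra.
-/

open Submodule

section CyclicModules

variable {R E Y T : Type*} [CommRing R] [Ring E] [Algebra R E]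
  [AddCommGroup Y] [Module E Y]
  [AddCommGroup T] [Module R T] [Module E T] [IsScalarTower R E T]

theorem exists_linearMap_span_singleton_apply_eq {y : Y} {t : T}
    (h : ∀ a : E, a • y = 0 → a • t = 0) :
    ∃ g : span E {y} →ₗ[E] T, g ⟨y, mem_span_singleton_self y⟩ = t := by
  let e := Ideal.quotTorsionOfEquivSpanSingleton E Y y
  have he : e (Submodule.Quotient.mk 1) = ⟨y, mem_span_singleton_self y⟩ := by
    rw [Ideal.quotTorsionOfEquivSpanSingleton_apply_mk, one_smul]
  refine ⟨(Ideal.torsionOf E Y y).liftQ (LinearMap.toSpanSingleton E T t) h ∘ₗ e.symm, ?_⟩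
  rw [← he, LinearMap.comp_apply, LinearEquiv.coe_coe, e.symm_apply_apply]
  exact one_smul E t

theorem length_add_length_linearMap_le {y : Y} {C : Submodule E Y} (hC : IsCompl (span E {y}) C)
    (h : ∀ a : E, a • y = 0 → ∀ t : T, a • t = 0) :
    Module.length R T + Module.length R (C →ₗ[E] T) ≤ Module.length R (Y →ₗ[E] T) := by
  rw [← Module.length_prod]
  refine Module.length_le_of_surjective
    ((LinearMap.applyₗ' R y).prod (LinearMap.lcomp R T C.subtype)) fun ⟨t, k⟩ ↦ ?_
  obtain ⟨g, hg⟩ := exists_linearMap_span_singleton_apply_eq fun a ha ↦ h a ha t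
  refine ⟨LinearMap.ofIsCompl hC g k, Prod.ext ?_ ?_⟩
  · exact (LinearMap.ofIsCompl_apply_left hC ⟨y, mem_span_singleton_self y⟩).trans hg
  · ext c
    exact LinearMap.ofIsCompl_apply_right hC c

theorem span_singleton_lt_span_singleton_add {y t : Y} {N : Submodule E Y} [IsSimpleModule E N]
    (hN : Disjoint (span E {y}) N) (ht : t ∈ N) {a : E} (hay : a • y = 0) (hat : a • t ≠ 0) :
    span E {y} < span E {y + t} := by
  have hyt : y + t ∈ span E {y + t} := mem_span_singleton_self _
  have haS : a • t ∈ span E {y + t} := by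
    simpa [hay] using (span E {y + t}).smul_mem a hyt
  have htS : t ∈ span E {y + t} := by
    have hmem : (⟨t, ht⟩ : N) ∈ span E {a • (⟨t, ht⟩ : N)} := by
      rw [IsSimpleModule.span_singleton_eq_top E fun h ↦ hat (congrArg Subtype.val h)]
      exact mem_top
    obtain ⟨c, hc⟩ := mem_span_singleton.mp hmem
    have hca : c • a • t = t := congrArg Subtype.val hc
    exact (congrArg (· ∈ span E {y + t}) hca).mp (smul_mem _ c haS)
  refine lt_of_le_of_ne ?_ fun heq ↦ hat ?_
  · rw [span_singleton_le_iff_mem]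
    simpa using sub_mem hyt htS
  · rw [disjoint_def.mp hN t (heq ▸ htS) ht, smul_zero]

theorem exists_span_singleton_eq_top_of_length_linearMap_le [Module R Y]
    [IsScalarTower R E Y] [IsSemisimpleModule E Y] (hY : IsFiniteLength R Y)
    (h : ∀ N : Submodule E Y, IsSimpleModule E N →
      Module.length R (Y →ₗ[E] N) ≤ Module.length R N) :
    ∃ y : Y, span E {y} = ⊤ := by
  obtain ⟨_, _⟩ := isFiniteLength_iff_isNoetherian_isArtinian.mp hY
  have : IsNoetherian E Y := isNoetherian_of_tower R ‹_›
  obtain ⟨_, ⟨y, rfl⟩, hmax⟩ := set_has_maximal_iff_noetherian.mpr ‹IsNoetherian E Y›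
    (Set.range fun y : Y ↦ span E {y}) (Set.range_nonempty _)
  refine ⟨y, by_contra fun hy ↦ ?_⟩
  obtain ⟨C, hC⟩ := exists_isCompl (span E {y})
  obtain ⟨N, hNC, _⟩ := (IsSemisimpleModule.eq_bot_or_exists_simple_le C).resolve_left
    fun hbot ↦ hy (by simpa [hbot] using hC.sup_eq_top)
  have hann (a : E) (ha : a • y = 0) (t : N) : a • t = 0 := by
    by_contra hat
    exact hmax _ ⟨y + t, rfl⟩ (span_singleton_lt_span_singleton_add
      (hC.disjoint.mono_right hNC) t.2 ha fun h0 ↦ hat (Subtype.ext h0))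
  have hHom : Nontrivial (C →ₗ[E] N) := by
    have := IsSimpleModule.nontrivial E N
    obtain ⟨t, ht⟩ := exists_ne (0 : N)
    obtain ⟨p, hp⟩ := exists_isCompl N
    refine ⟨N.projectionOnto p hp ∘ₗ C.subtype, 0, fun h0 ↦ ht ?_⟩
    rw [← N.projectionOnto_apply_left hp t]
    exact LinearMap.congr_fun h0 ⟨t, hNC t.2⟩
  have hN : Module.length R N ≠ ⊤ :=
    (Module.length_ne_top (R := R) (M := N.restrictScalars R))
  refine (lt_of_lt_of_le ?_ (length_add_length_linearMap_le (R := R) hC hann)).not_ge (h N ‹_›)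
  rw [add_comm]
  exact ENat.lt_add_left hN Module.length_pos

theorem length_linearMap_le_of_span_range_eq_top {ι : Type*} [Finite ι] [Nonempty ι]
    {w : ι → ι → Y} (hw : span E (Set.range w) = ⊤) :
    Module.length R (Y →ₗ[E] T) ≤ Module.length R T := by
  classical
  have := Fintype.ofFinite ι
  let e := LinearMap.lsum (M := T) E (fun _ : ι ↦ Y) R
  let ev : ((ι → Y) →ₗ[E] T) →ₗ[R] ι → T := LinearMap.pi fun i ↦ LinearMap.applyₗ' R (w i)
  have hev : Function.Injective ev := fun g g' hgg' ↦ LinearMap.ext_on_range hw (congrFun hgg')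
  have hle := Module.length_le_of_injective (ev ∘ₗ e.toLinearMap) (hev.comp e.injective)
  simp only [Module.length_pi_of_fintype, Finset.sum_const, nsmul_eq_mul] at hle
  exact (ENat.mul_le_mul_left_iff (by simp) (ENat.natCast_ne_top _)).mp hle

end CyclicModules

section SemilocalBase

variable {R E P : Type*} [CommRing R] [Ring E] [Algebra R E]
  [AddCommGroup P] [Module R P] [Module E P] [IsScalarTower R E P] [Module.Finite R P]

theorem smul_eq_zero_of_mem_jacobson_of_isSimpleModule [IsSimpleModule E P] {r : R}
    (hr : r ∈ Ring.jacobson R) (x : P) : r • x = 0 := by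
  have := IsSimpleModule.nontrivial E P
  let f : P →ₗ[E] P := r • LinearMap.id
  suffices hf : f = 0 from LinearMap.congr_fun hf x
  by_contra hf
  have hsurj : Function.Surjective f := LinearMap.surjective_of_ne_zero hf
  refine top_ne_pointwise_smul_of_mem_jacobson_annihilator (R := R) (M := P) (r := r)
    (Ideal.jacobson_mono bot_le (Ideal.jacobson_bot (R := R) ▸ hr)) (le_antisymm ?_ le_top)
  intro x _
  obtain ⟨y, rfl⟩ := hsurj x
  exact smul_mem_pointwise_smul _ _ _ trivial

theorem smul_mem_jacobson_of_mem_jacobson {r : R} (hr : r ∈ Ring.jacobson R) (x : P) :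
    r • x ∈ Module.jacobson E P := by
  refine mem_sInf.mpr fun N (hN : IsCoatom N) ↦ ?_
  have : IsSimpleModule E (P ⧸ N) := isSimpleModule_iff_isCoatom.mpr hN
  have : Module.Finite R (P ⧸ N) := .of_surjective (N.mkQ.restrictScalars R) N.mkQ_surjective
  rw [← Submodule.Quotient.mk_eq_zero, Submodule.Quotient.mk_smul]
  exact smul_eq_zero_of_mem_jacobson_of_isSimpleModule (E := E) hr _

instance isArtinianRing_quotient_jacobson [Finite (MaximalSpectrum R)] :
    IsArtinianRing (R ⧸ Ring.jacobson R) := by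
  let f : R →ₗ[R] ∀ m : MaximalSpectrum R, R ⧸ m.asIdeal := LinearMap.pi fun m ↦ m.asIdeal.mkQ
  have hf : LinearMap.ker f = Ring.jacobson R := by
    ext r
    rw [Ring.jacobson_eq_sInf_isMaximal, Ideal.mem_sInf, LinearMap.mem_ker, funext_iff]
    exact ⟨fun h I hI ↦ Ideal.Quotient.eq_zero_iff_mem.mp (h ⟨I, hI⟩),
      fun h m ↦ Ideal.Quotient.eq_zero_iff_mem.mpr (h m.isMaximal)⟩
  have (m : MaximalSpectrum R) : IsSimpleModule R (R ⧸ m.asIdeal) :=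
    isSimpleModule_iff_isCoatom.mpr m.isMaximal.out
  have hinj : Function.Injective ((Ring.jacobson R).liftQ f hf.ge) :=
    LinearMap.ker_eq_bot.mp (ker_liftQ_eq_bot _ _ _ hf.le)
  exact isArtinian_of_tower R (isArtinian_of_injective _ hinj)

variable [Finite (MaximalSpectrum R)]

theorem isFiniteLength_of_jacobson_smul_eq_zero
    (h : ∀ r ∈ Ring.jacobson R, ∀ x : P, r • x = 0) : IsFiniteLength R P := by
  have htors : Module.IsTorsionBySet R P (Ring.jacobson R) := fun x r ↦ h r r.2 x
  let : Module (R ⧸ Ring.jacobson R) P := htors.module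
  have : IsScalarTower R (R ⧸ Ring.jacobson R) P := htors.isScalarTower
  have : Module.Finite (R ⧸ Ring.jacobson R) P := .of_restrictScalars_finite R _ _
  rw [← Module.length_ne_top_iff,
    Module.length_eq_of_surjective (R := R ⧸ Ring.jacobson R) Ideal.Quotient.mk_surjective]
  exact Module.length_ne_top

variable (R E P) in
theorem isFiniteLength_quotient_jacobson : IsFiniteLength R (P ⧸ Module.jacobson E P) := by
  have : Module.Finite R (P ⧸ Module.jacobson E P) :=
    .of_surjective ((Module.jacobson E P).mkQ.restrictScalars R)
      (Module.jacobson E P).mkQ_surjective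
  refine isFiniteLength_of_jacobson_smul_eq_zero fun r hr x ↦ ?_
  obtain ⟨p, rfl⟩ := Submodule.Quotient.mk_surjective _ x
  rw [← Submodule.Quotient.mk_smul, Submodule.Quotient.mk_eq_zero]
  exact smul_mem_jacobson_of_mem_jacobson hr p

end SemilocalBase

theorem isSemisimpleModule_quotient_jacobson (R E P : Type*)
    [CommRing R] [Finite (MaximalSpectrum R)] [Ring E] [Algebra R E] [AddCommGroup P] [Module R P]
    [Module E P] [IsScalarTower R E P] [Module.Finite R P] :
    IsSemisimpleModule E (P ⧸ Module.jacobson E P) := by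
  have hArt := (isFiniteLength_iff_isNoetherian_isArtinian.mp
    (isFiniteLength_quotient_jacobson R E P)).2
  have : IsArtinian E (P ⧸ Module.jacobson E P) := isArtinian_of_tower R hArt
  exact (IsArtinian.isSemisimpleModule_iff_jacobson E _).mpr (Module.jacobson_quotient_jacobson E P)

theorem exists_span_singleton_eq_top_of_quotient_jacobson {E P : Type*} [Ring E] [AddCommGroup P]
    [Module E P] [Module.Finite E P]
    (h : ∃ y : P ⧸ Module.jacobson E P, span E {y} = ⊤) : ∃ x : P, span E {x} = ⊤ := by
  obtain ⟨y, hy⟩ := h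
  obtain ⟨x, rfl⟩ := Submodule.Quotient.mk_surjective _ y
  have hsup : Module.jacobson E P ⊔ span E {x} = ⊤ := by
    rw [← comap_map_mkQ, map_span, Set.image_singleton, mkQ_apply, hy, comap_top]
  refine ⟨x, (eq_top_or_exists_le_coatom (span E {x})).resolve_right ?_⟩
  rintro ⟨N, hN, hxN⟩
  exact hN.1 (eq_top_iff.mpr (hsup ▸ sup_le (sInf_le hN) hxN))

theorem exists_span_singleton_eq_top_of_span_range_eq_top (R : Type*) {E P ι : Type*}
    [CommRing R] [Finite (MaximalSpectrum R)] [Ring E] [Algebra R E] [AddCommGroup P] [Module R P]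
    [Module E P] [IsScalarTower R E P] [Module.Finite R P] [Finite ι] [Nonempty ι]
    {w : ι → ι → P} (hw : span E (Set.range w) = ⊤) : ∃ x : P, span E {x} = ⊤ := by
  have : Module.Finite E P := .of_restrictScalars_finite R E P
  have := isSemisimpleModule_quotient_jacobson R E P
  refine exists_span_singleton_eq_top_of_quotient_jacobson
    (exists_span_singleton_eq_top_of_length_linearMap_le
      (isFiniteLength_quotient_jacobson R E P) fun N _ ↦ ?_)
  calc Module.length R (P ⧸ Module.jacobson E P →ₗ[E] N)
      ≤ Module.length R (P →ₗ[E] N) :=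
        Module.length_le_of_injective (LinearMap.lcomp R N (Module.jacobson E P).mkQ)
          (LinearMap.lcomp_injective_of_surjective _ (mkQ_surjective _))
    _ ≤ Module.length R N := length_linearMap_le_of_span_range_eq_top hw

section Intertwiners

variable (R : Type*) {M : Type*} [CommRing R] [Ring M] [Algebra R M]

/-- The elements `x` of an algebra with `x * a = b * x`, as a left module over the centralizer
of `b`. -/
def intertwiners (a b : M) : Submodule (Subalgebra.centralizer R {b}) M where
  carrier := {x | SemiconjBy x a b}
  add_mem' := SemiconjBy.add_left
  zero_mem' := SemiconjBy.zero_left a b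
  smul_mem' c _ hx := SemiconjBy.mul_left (c.2 b rfl).symm hx

variable {R}

theorem mem_intertwiners {a b x : M} : x ∈ intertwiners R a b ↔ SemiconjBy x a b := Iff.rfl

instance finite_intertwiners [IsNoetherianRing R] [Module.Finite R M] (a b : M) :
    Module.Finite R (intertwiners R a b) :=
  .of_injective ((intertwiners R a b).subtype.restrictScalars R) Subtype.val_injective

theorem exists_span_singleton_intertwiners_eq_top [IsNoetherianRing R] [Finite (MaximalSpectrum R)]
    [Module.Finite R M] {ι : Type*} [Finite ι] [Nonempty ι] {a b : M}
    {w : ι → ι → intertwiners R a b}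
    (hw : span (Subalgebra.centralizer R {b}) (Set.range w) = ⊤) :
    ∃ f : intertwiners R a b, span (Subalgebra.centralizer R {b}) {f} = ⊤ :=
  exists_span_singleton_eq_top_of_span_range_eq_top R hw

end Intertwiners

section ScalarExtension

variable {R S l m n ι : Type*} [CommRing R] [CommRing S] [Algebra R S]

theorem sum_smul_matrix_map_coord [Fintype ι] (b : Module.Basis ι R S) (Z : Matrix m n S) :
    ∑ i, b i • (Z.map (b.coord i)).map (algebraMap R S) = Z := by
  ext p q
  simp only [Matrix.sum_apply, Matrix.smul_apply, Matrix.map_apply, smul_eq_mul, ← Algebra.commutes,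
    ← Algebra.smul_def, Module.Basis.coord_apply, b.sum_repr]

theorem matrix_map_coord_sum_smul [Fintype ι] (b : Module.Basis ι R S) (Y : ι → Matrix m n R)
    (i : ι) :
    (∑ j, b j • (Y j).map (algebraMap R S)).map (b.coord i) = Y i := by
  classical
  ext p q
  simp [Matrix.sum_apply, ← Algebra.commutes, ← Algebra.smul_def, Finsupp.single_apply]

variable [Fintype n]

theorem matrix_map_mul_map_algebraMap (φ : S →ₗ[R] R) (Z : Matrix l n S) (A : Matrix n m R) :
    (Z * A.map (algebraMap R S)).map φ = Z.map φ * A := by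
  ext i j
  simp only [Matrix.map_apply, Matrix.mul_apply, map_sum, ← Algebra.commutes, ← Algebra.smul_def,
    map_smul, smul_eq_mul]
  exact Finset.sum_congr rfl fun k _ ↦ mul_comm _ _

theorem matrix_map_map_algebraMap_mul (φ : S →ₗ[R] R) (A : Matrix l n R) (Z : Matrix n m S) :
    (A.map (algebraMap R S) * Z).map φ = A * Z.map φ := by
  ext i j
  simp only [Matrix.map_apply, Matrix.mul_apply, map_sum, ← Algebra.smul_def, map_smul, smul_eq_mul]

theorem semiconjBy_map_of_map_algebraMap (φ : S →ₗ[R] R) {Z : Matrix n n S}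
    {A B : Matrix n n R} (h : SemiconjBy Z (A.map (algebraMap R S)) (B.map (algebraMap R S))) :
    SemiconjBy (Z.map φ) A B := by
  rw [SemiconjBy, ← matrix_map_mul_map_algebraMap, h.eq, matrix_map_map_algebraMap_mul]

variable [DecidableEq n]

theorem exists_span_range_intertwiners_eq_top [Finite ι] (b : Module.Basis ι R S)
    {A B : Matrix n n R} (U : (Matrix n n S)ˣ)
    (hU : SemiconjBy ↑U (A.map (algebraMap R S)) (B.map (algebraMap R S))) :
    ∃ w : ι → ι → intertwiners R A B,
      span (Subalgebra.centralizer R {B}) (Set.range w) = ⊤ := by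
  have := Fintype.ofFinite ι
  let w (k i : ι) : intertwiners R A B :=
    ⟨(b k • (U : Matrix n n S)).map (b.coord i),
      semiconjBy_map_of_map_algebraMap _ (by
        rw [SemiconjBy, smul_mul_assoc, hU.eq, mul_smul_comm])⟩
  refine ⟨w, eq_top_iff.mpr fun Y _ ↦ ?_⟩
  let Z : Matrix n n S := ∑ j, b j • (Y j : Matrix n n R).map (algebraMap R S)
  have hZ : SemiconjBy Z (A.map (algebraMap R S)) (B.map (algebraMap R S)) := by
    simp only [Z, SemiconjBy, Finset.sum_mul, Finset.mul_sum, smul_mul_assoc, mul_smul_comm,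
      ← Matrix.map_mul, (mem_intertwiners.mp (Y _).2).eq]
  have hZU : SemiconjBy (Z * (↑U⁻¹ : Matrix n n S)) (B.map (algebraMap R S))
      (B.map (algebraMap R S)) :=
    hZ.mul_left hU.units_inv_symm_left
  let X (k : ι) : Subalgebra.centralizer R {B} :=
    ⟨(Z * (↑U⁻¹ : Matrix n n S)).map (b.coord k), by
      rintro _ rfl
      exact (semiconjBy_map_of_map_algebraMap _ hZU).eq.symm⟩
  refine (mem_span_range_iff_exists_fun _).mpr ⟨X, funext fun i ↦ Subtype.ext ?_⟩
  calc ((∑ k, X k • w k) i : Matrix n n R)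
      = ∑ k, (X k : Matrix n n R) * (b k • (U : Matrix n n S)).map (b.coord i) := by
        rw [Finset.sum_apply, coe_sum]
        rfl
    _ = ((∑ k, b k • (X k : Matrix n n R).map (algebraMap R S)) * U).map (b.coord i) := by
        simp only [← matrix_map_map_algebraMap_mul, smul_mul_assoc, mul_smul_comm, Finset.sum_mul]
        ext p q
        simp [Matrix.sum_apply]
    _ = Z.map (b.coord i) := by rw [sum_smul_matrix_map_coord, mul_assoc, Units.inv_mul, mul_one]
    _ = Y i := matrix_map_coord_sum_smul b _ i

theorem exists_mul_map_algebraMap_eq_of_span_singleton [Finite ι] (b : Module.Basis ι R S)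
    {A B : Matrix n n R} {f : intertwiners R A B} (hf : span (Subalgebra.centralizer R {B}) {f} = ⊤)
    {Z : Matrix n n S}
    (hZ : SemiconjBy Z (A.map (algebraMap R S)) (B.map (algebraMap R S))) :
    ∃ V : Matrix n n S, V * (f : Matrix n n R).map (algebraMap R S) = Z := by
  have := Fintype.ofFinite ι
  have hcoord (i : ι) : ∃ c : Subalgebra.centralizer R {B}, (c : Matrix n n R) * f =
      Z.map (b.coord i) := by
    let z : intertwiners R A B :=
      ⟨Z.map (b.coord i), semiconjBy_map_of_map_algebraMap _ hZ⟩
    obtain ⟨c, hc⟩ := mem_span_singleton.mp (hf.ge (mem_top (x := z)))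
    exact ⟨c, congrArg Subtype.val hc⟩
  choose c hc using hcoord
  refine ⟨∑ i, b i • (c i : Matrix n n R).map (algebraMap R S), ?_⟩
  simp only [Finset.sum_mul, smul_mul_assoc, ← Matrix.map_mul, hc, sum_smul_matrix_map_coord]

theorem isUnit_of_isUnit_matrix_map [IsLocalHom (algebraMap R S)] {f : Matrix n n R}
    (hf : IsUnit (f.map (algebraMap R S))) : IsUnit f := by
  refine (Matrix.isUnit_iff_isUnit_det f).mpr (isUnit_of_map_unit (algebraMap R S) _ ?_)
  rw [RingHom.map_det]
  exact (Matrix.isUnit_iff_isUnit_det _).mp hf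

theorem isConj_of_isConj_map_of_free [IsNoetherianRing R] [Finite (MaximalSpectrum R)]
    [Nontrivial S] [Module.Finite R S] [Module.Free R S] {A B : Matrix n n R}
    (h : IsConj (A.map (algebraMap R S)) (B.map (algebraMap R S))) : IsConj A B := by
  obtain ⟨U, hU⟩ := h
  let b := Module.Free.chooseBasis R S
  have := b.index_nonempty
  obtain ⟨w, hw⟩ := exists_span_range_intertwiners_eq_top b U hU
  obtain ⟨f, hf⟩ := exists_span_singleton_intertwiners_eq_top hw
  obtain ⟨V, hV⟩ := exists_mul_map_algebraMap_eq_of_span_singleton b hf hU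
  have hfu : IsUnit (f : Matrix n n R) :=
    isUnit_of_isUnit_matrix_map (isUnit_of_mul_isUnit_right (hV ▸ U.isUnit))
  exact ⟨hfu.unit, f.2⟩

theorem exists_fg_subalgebra_units_map_eq (U : (Matrix n n S)ˣ) :
    ∃ S' : Subalgebra R S, S'.FG ∧
      ∃ U' : (Matrix n n S')ˣ, (U' : Matrix n n S').map S'.val = U := by
  let s : Set S := Set.range (fun p : n × n ↦ (U : Matrix n n S) p.1 p.2) ∪
    Set.range fun p : n × n ↦ (↑U⁻¹ : Matrix n n S) p.1 p.2
  let S' := Algebra.adjoin R s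
  let W : Matrix n n S' := .of fun i j ↦
    ⟨(U : Matrix n n S) i j, Algebra.subset_adjoin (.inl ⟨(i, j), rfl⟩)⟩
  let W' : Matrix n n S' := .of fun i j ↦
    ⟨(↑U⁻¹ : Matrix n n S) i j, Algebra.subset_adjoin (.inr ⟨(i, j), rfl⟩)⟩
  have hinj : Function.Injective fun M : Matrix n n S' ↦ M.map S'.val :=
    Matrix.map_injective Subtype.val_injective
  have hWW' : W * W' = 1 := hinj (Matrix.map_mul.trans (U.mul_inv.trans (by simp)))
  have hW'W : W' * W = 1 := hinj (Matrix.map_mul.trans (U.inv_mul.trans (by simp)))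
  exact ⟨S', Subalgebra.fg_def.mpr ⟨s, (Set.finite_range _).union (Set.finite_range _), rfl⟩,
    ⟨W, W', hWW', hW'W⟩, rfl⟩

theorem isConj_of_isConj_map_of_isIntegral [IsDomain R] [IsPrincipalIdealRing R]
    [Finite (MaximalSpectrum R)] [Nontrivial S] [Algebra.IsIntegral R S] [Module.IsTorsionFree R S]
    {A B : Matrix n n R} (h : IsConj (A.map (algebraMap R S)) (B.map (algebraMap R S))) :
    IsConj A B := by
  obtain ⟨U, hU⟩ := h
  obtain ⟨S', hfg, U', hU'⟩ := exists_fg_subalgebra_units_map_eq (R := R) U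
  have : Algebra.FiniteType R S' := S'.fg_iff_finiteType.mp hfg
  have : Algebra.IsIntegral R S' := .of_injective S'.val Subtype.val_injective
  have : Module.Finite R S' := Algebra.IsIntegral.finite
  refine isConj_of_isConj_map_of_free (S := S') ⟨U', ?_⟩
  refine Matrix.map_injective (f := S'.val) Subtype.val_injective ?_
  beta_reduce
  rw [Matrix.map_mul, Matrix.map_mul, hU']
  exact hU

theorem theorem3_general {L : Type*} [IsDomain R] [IsPrincipalIdealRing R]
    [Finite (MaximalSpectrum R)] [CommRing L] [Nontrivial L] [Algebra R L]
    [Module.IsTorsionFree R L] [Algebra S L] [IsScalarTower R S L] [IsIntegralClosure S R L]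
    (A B : Matrix n n R) :
    IsConj A B ↔ IsConj (A.map (algebraMap R S)) (B.map (algebraMap R S)) := by
  refine ⟨fun h ↦ (algebraMap R S).mapMatrix.toMonoidHom.map_isConj h, fun h ↦ ?_⟩
  have : Nontrivial S := (algebraMap S L).domain_nontrivial
  have : Algebra.IsIntegral R S := IsIntegralClosure.isIntegral_algebra R L
  have : Module.IsTorsionFree R S :=
    (IsIntegralClosure.algebraMap_injective S R L).moduleIsTorsionFree _
      fun r s ↦ map_smul (IsScalarTower.toAlgHom R S L) r s
  exact isConj_of_isConj_map_of_isIntegral h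

end ScalarExtension

/-- Similarity of square matrices over a commutative ring is `IsConj` in the matrix ring
(conjugacy by a unit, i.e. by an element of `GL n`). Separability of the characteristic
polynomial is meant over the fraction field `K`. -/
theorem theorem3
    {R K L S : Type*} [CommRing R] [IsDomain R] [IsDiscreteValuationRing R]
    [Field K] [Algebra R K] [IsFractionRing R K]
    [Field L] [Algebra K L] [FiniteDimensional K L]
    [Algebra R L] [IsScalarTower R K L]
    [CommRing S] [Algebra R S] [Algebra S L] [IsScalarTower R S L] [IsIntegralClosure S R L]
    (n : ℕ) (A B : Matrix (Fin n) (Fin n) R)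
    (h : (A.charpoly.map (algebraMap R K)).Separable ∨ n = 2) :
    IsConj A B ↔ IsConj (A.map (algebraMap R S)) (B.map (algebraMap R S)) := by
  have : Module.IsTorsionFree R L := .trans_faithfulSMul R K L
  exact theorem3_general (L := L) A B
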